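/- **Setting.** $\Lambda$ is the set of $\lambda$-terms, $(v)u$ denotes $v$ applied to $u$, and $\mathcal M_{\rm fin}(X)$ is the set of finite multisets of elements of $X$. A term is *normal* if it contains no $\beta$-redex. Terms are raw terms with named variables; a term *respects the variable convention* if every variable is bound at most once in it. *Points.* Let $A$ be a non-empty set of atoms and let $D$ be the least set with $D = A\,\dot\cup\,(\mathcal M_{\rm fin}(D)\times D)$. Define $|\alpha|$ and $\mathsf{aux}(\alpha)$ by: $|\gamma|=1$, $\mathsf{aux}(\gamma)=0$ for $\gamma\in A$; for $\alpha=([\alpha_1,\dots,\alpha_n],\alpha_0)$, $|\alpha|=\sum_{i=1}^n\mathsf{aux}(\alpha_i)+|\alpha_0|+1$ and $\mathsf{aux}(\alpha)=\sum_{i=1}^n|\alpha_i|+\mathsf{aux}(\alpha_0)+1$. For $a=[\alpha_1,\dots,\alpha_n]$ put $|a|=\sum_i|\alpha_i|$. The sets $D^{\sf ex}$ and $\overline{D^{\sf ex}}$ are the least sets containing $A$ such that $(a,\alpha)\in D^{\sf ex}$ whenever $a\in\mathcal M_{\rm fin}(\overline{D^{\sf ex}})$ and $\alpha\in D^{\sf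 ex}$, and $(a,\alpha)\in\overline{D^{\sf ex}}$ whenever $a\in\mathcal M_{\rm fin}(D^{\sf ex})$, $a\neq[\,]$ and $\alpha\in\overline{D^{\sf ex}}$. *Semantics.* For distinct variables $x_1,\dots,x_m$ containing the free variables of $t$, $[\![t]\!]_{x_1,\dots,x_m}\subseteq\mathcal M_{\rm fin}(D)^m\times D$ is defined by induction on $t$: $[\![x_j]\!]$ is the set of all $(([\,],\dots,[\alpha],\dots,[\,]),\alpha)$ with $[\alpha]$ in position $j$; $[\![\lambda x.w]\!]_{x_1,\dots,x_m}$ is the set of all $((a_1,\dots,a_m),(a,\alpha))$ with $((a_1,\dots,a_m,a),\alpha)\in[\![w]\!]_{x_1,\dots,x_m,x}$ (bound variables being renamed where necessary); $[\![(v)w]\!]$ is the set of all $(\sum_{i=0}^n\vec a^{\,i},\alpha)$ such that, for some $n\ge 0$ and $\alpha_1,\dots,\alpha_n\in D$, $(\vec a^{\,0},([\alpha_1,\dots,\alpha_n],\alpha))\in[\![v]\!]$ and $(\vec a^{\,i},\alpha_i)\in[\![w]\!]$ for $1\le i\le n$. For closed $t$ and $m=0$ this gives $[\![t]\!]\subseteq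 D$. *Machines.* An environment is a finite partial map from variables to closures, a closure is a pair $(t,e)$ of a term and an environment, and a state is a non-empty finite sequence of closures, written $c.\pi$; $\epsilon$ is the empty sequence. On states, $(x,e).\pi\succ e(x).\pi$ if $x\in\mathrm{dom}(e)$; $(\lambda x.w,e).(c.\pi)\succ(w,\{(x,c)\}\cup e).\pi$; $((v)w,e).\pi\succ(v,e).((w,e).\pi)$. In the two remaining cases the machines continue as follows. Both send $(\lambda x.w,e).\epsilon$ to $\lambda x.((w,e).\epsilon)$ and go on executing under the $\lambda$. For $x\notin\mathrm{dom}(e)$, the first machine ($\succ_h$) sends $((x,e),c_1,\dots,c_q)$ to the term $(x)\overline{c_1}\cdots\overline{c_q}$, where $\overline{c}=t[e]$ is the term denoted by $c=(t,e)$ (the variables of $\mathrm{dom}(e)$ being replaced by the terms denoted by their values), and stops there; the second machine ($\succ_\beta$) sends it to $(x)(c_1.\epsilon)\cdots(c_q.\epsilon)$ and then executes all the arguments $c_i.\epsilon$, from left to right. For a configuration $k$, $l_h(k)$ (resp. $l_\beta(k)$) $\in\mathbb N\cup\{\infty\}$ is the number of steps of $\succ_h$ (resp. $\succ_\beta$)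 from $k$ until no step is possible, and $\infty$ if the execution does not terminate. When a term $t$ is executed, from the state $(t,\emptyset).\epsilon$, its bound variables are first renamed so that it respects the variable convention. **Theorem.** Let $v$ and $u$ be closed normal $\lambda$-terms, let $a\in\mathcal M_{\rm fin}(D)$ and $\alpha\in D$ be such that $(a,\alpha)\in[\![v]\!]$ and every element of the support of $a$ belongs to $[\![u]\!]$. Then, for every renaming of the bound variables of $(v)u$ that makes it respect the variable convention, 1. $l_h(((v)u,\emptyset).\epsilon)\le 2|a|+|\alpha|+2$; 2. if, moreover, $\alpha\in D^{\sf ex}$, then $l_\beta(((v)u,\emptyset).\epsilon)\le 2|a|+|\alpha|+2$. -/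

import Mathlib

namespace ExecTime

universe u

/-! ### Points of the relational model

The set `D` of points over a set `A` of atoms: the least solution of
`D = A ⊔ (Mfin(D) × D)` (disjoint union), i.e. the initial algebra of the functor
`X ↦ A ⊕ (Multiset X × X)`. -/

/-- The functor `X ↦ A ⊕ (Multiset X × X)`. -/
inductive PointF (A X : Type u) : Type u
  | atom (c : A)
  | arrow (a : Multiset X) (y : X)

/-- The functorial action of `PointF A`. -/
def PointF.map {A X Y : Type u} (f : X → Y) : PointF A X → PointF A Y
  | .atom c => .atom c
  | .arrow a y => .arrow (a.map f) (f y)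

instance PointF.functor (A : Type u) : Functor (PointF A) where
  map f x := PointF.map f x

/-- `PointF A` is a quotient of a polynomial functor, so that it has an initial algebra. -/
noncomputable instance PointF.qpf (A : Type u) : QPF (PointF A) where
  P := { A := A ⊕ ℕ,
         B := fun s => Sum.elim (fun _ => PEmpty.{u + 1}) (fun n => ULift.{u} (Option (Fin n))) s }
  abs := fun {X} p => match p with
    | ⟨Sum.inl c, _⟩ => .atom c
    | ⟨Sum.inr n, f⟩ => .arrow
        ((List.ofFn fun i : Fin n => (f ⟨some i⟩ : X)) : Multiset X) (f ⟨none⟩ : X)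
  repr := fun {X} x => match x with
    | .atom c => ⟨Sum.inl c, fun b => PEmpty.elim b⟩
    | .arrow a y => ⟨Sum.inr a.toList.length,
        fun o => (Option.elim o.down y (fun i => a.toList.get i) : X)⟩
  abs_repr := by
    rintro X (c | ⟨a, y⟩)
    · rfl
    · change PointF.arrow (List.ofFn a.toList.get : List X) y = PointF.arrow a y
      rw [List.ofFn_get, Multiset.coe_toList]
  abs_map := by
    rintro X Y g ⟨c | n, f⟩
    · rfl
    · change PointF.arrow _ _ = PointF.arrow _ _
      simp only [Multiset.map_coe, List.map_ofFn]
      rfl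

/-- The set `D` of points over the set `A` of atoms. -/
def Pt (A : Type u) : Type u := QPF.Fix (PointF A)

namespace Pt

variable {A : Type u}

/-- The bijection from `A ⊕ (Multiset D × D)` to `D`. -/
noncomputable def mk (x : PointF A (Pt A)) : Pt A := QPF.Fix.mk x

/-- The inverse of `Pt.mk`. -/
noncomputable def dest (α : Pt A) : PointF A (Pt A) := QPF.Fix.dest α

theorem dest_mk (x : PointF A (Pt A)) : dest (mk x) = x := QPF.Fix.dest_mk x

theorem mk_dest (α : Pt A) : mk (dest α) = α := QPF.Fix.mk_dest α

/-- An atom, seen as a point. -/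
noncomputable def atom (c : A) : Pt A := mk (.atom c)

/-- The point `(a, α)`, for `a` a finite multiset of points and `α` a point. -/
noncomputable def arrow (a : Multiset (Pt A)) (α : Pt A) : Pt A := mk (.arrow a α)

theorem atom_injective {c c' : A} (h : atom c = atom c') : c = c' := by
  have h' := congrArg dest h
  rw [atom, atom, dest_mk, dest_mk] at h'
  exact PointF.atom.inj h'

theorem arrow_injective {a a' : Multiset (Pt A)} {α α' : Pt A} (h : arrow a α = arrow a' α') :
    a = a' ∧ α = α' := by
  have h' := congrArg dest h
  rw [arrow, arrow, dest_mk, dest_mk] at h'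
  exact PointF.arrow.inj h'

theorem atom_ne_arrow {c : A} {a : Multiset (Pt A)} {α : Pt A} : atom c ≠ arrow a α := by
  intro h
  have h' := congrArg dest h
  rw [atom, arrow, dest_mk, dest_mk] at h'
  cases h'

/-- Every point is obtained from atoms by finitely many uses of `arrow`. -/
theorem induction {p : Pt A → Prop} (atom : ∀ c, p (atom c))
    (arrow : ∀ a α, (∀ β ∈ a, p β) → p α → p (arrow a α)) (α : Pt A) : p α := by
  refine QPF.Fix.ind (F := PointF A) p ?_ α
  rintro (c | ⟨a, α⟩) h
  · exact atom c
  · obtain ⟨z, hz⟩ := h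
    rcases z with c | ⟨b, β⟩
    · cases hz
    · obtain ⟨h1, h2⟩ := PointF.arrow.inj hz
      refine arrow a α ?_ ?_
      · intro γ hγ
        rw [← h1] at hγ
        obtain ⟨δ, -, rfl⟩ := Multiset.mem_map.1 hγ
        exact δ.2
      · rw [← h2]
        exact β.2

/-- One step of the recursive definition of the pair `(|α|, aux(α))`. -/
def sizesStep : PointF A (ULift.{u} (ℕ × ℕ)) → ULift.{u} (ℕ × ℕ)
  | .atom _ => ⟨(1, 0)⟩
  | .arrow a r => ⟨((a.map fun s => s.down.2).sum + r.down.1 + 1,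
      (a.map fun s => s.down.1).sum + r.down.2 + 1)⟩

/-- The pair `(|α|, aux(α))`, by recursion on `α`. -/
noncomputable def sizes (α : Pt A) : ULift.{u} (ℕ × ℕ) :=
  QPF.Fix.rec (F := PointF A) sizesStep α

theorem sizes_mk (x : PointF A (Pt A)) : sizes (mk x) = sizesStep (PointF.map sizes x) :=
  QPF.Fix.rec_eq (F := PointF A) sizesStep x

/-- The size `|α|` of a point, characterized by `size_atom` and `size_arrow`. -/
noncomputable def size (α : Pt A) : ℕ := α.sizes.down.1

/-- The auxiliary size `aux(α)` of a point, characterized by `aux_atom` and `aux_arrow`. -/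
noncomputable def aux (α : Pt A) : ℕ := α.sizes.down.2

theorem size_atom (c : A) : (atom c).size = 1 := by
  rw [size, atom, sizes_mk]
  rfl

theorem aux_atom (c : A) : (atom c).aux = 0 := by
  rw [aux, atom, sizes_mk]
  rfl

theorem size_arrow (a : Multiset (Pt A)) (α : Pt A) :
    (arrow a α).size = (a.map aux).sum + α.size + 1 := by
  rw [size, arrow, sizes_mk]
  simp only [PointF.map, sizesStep, Multiset.map_map]
  rfl

theorem aux_arrow (a : Multiset (Pt A)) (α : Pt A) :
    (arrow a α).aux = (a.map size).sum + α.aux + 1 := by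
  rw [aux, arrow, sizes_mk]
  simp only [PointF.map, sizesStep, Multiset.map_map]
  rfl

/-- The size `|a|` of a finite multiset of points. -/
noncomputable def msize (a : Multiset (Pt A)) : ℕ := (a.map size).sum

mutual

/-- The set `D^ex`: the points without positive occurrence of the empty multiset. -/
inductive Ex : Pt A → Prop
  | atom (c : A) : Ex (atom c)
  | arrow (a : Multiset (Pt A)) (α : Pt A) :
      (∀ β ∈ a, CoEx β) → Ex α → Ex (arrow a α)

/-- The dual set: the points without negative occurrence of the empty multiset. -/
inductive CoEx : Pt A → Prop
  | atom (c : A) : CoEx (atom c)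
  | arrow (a : Multiset (Pt A)) (α : Pt A) :
      a ≠ 0 → (∀ β ∈ a, Ex β) → CoEx α → CoEx (arrow a α)

end

end Pt

/-! ### Lambda-terms -/

/-- Variables. -/
abbrev Var : Type := ℕ

/-- (Raw) lambda-terms with named variables. -/
inductive Term : Type
  | var (x : Var)
  | lam (x : Var) (t : Term)
  | app (v u : Term)

namespace Term

/-- The set of free variables. -/
def fv : Term → Finset Var
  | var x => {x}
  | lam x t => t.fv.erase x
  | app v u => v.fv ∪ u.fv

/-- A term is closed if it has no free variable. -/
def Closed (t : Term) : Prop := t.fv = ∅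

/-- The binding occurrences of variables, listed with repetitions. -/
def binders : Term → List Var
  | var _ => []
  | lam x t => x :: t.binders
  | app v u => v.binders ++ u.binders

/-- The variable convention: any variable is bound at most once. -/
def Conv (t : Term) : Prop := t.binders.Nodup

/-- A term is an abstraction. -/
def IsLam (t : Term) : Prop := ∃ x u, t = lam x u

/-- Beta-normal terms: no subterm is a redex `(λ x. t) u`. -/
def Normal : Term → Prop
  | var _ => True
  | lam _ t => t.Normal
  | app v u => v.Normal ∧ u.Normal ∧ ¬ v.IsLam

/-- A variable that does not belong to `s`. -/
def fresh (s : Finset Var) : Var := s.sup id + 1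

/-- Simultaneous capture-avoiding substitution; a binder is renamed only if it would capture. -/
def subst : Term → (Var → Term) → Term
  | var x, σ => σ x
  | app v u, σ => app (v.subst σ) (u.subst σ)
  | lam x t, σ =>
      let bad : Finset Var := (t.fv.erase x).biUnion fun y => (σ y).fv
      let z : Var := if x ∈ bad then fresh bad else x
      lam z (t.subst (Function.update σ x (var z)))

end Term

/-- `AlphaVar ρ x y`: the variable `x` on the left corresponds to `y` on the right, when `ρ` lists
the pairs of binders crossed so far, innermost first. -/
inductive AlphaVar : List (Var × Var) → Var → Var → Prop
  | free (x : Var) : AlphaVar [] x x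
  | here (ρ : List (Var × Var)) (x y : Var) : AlphaVar ((x, y) :: ρ) x y
  | there (ρ : List (Var × Var)) (x y x' y' : Var) :
      x ≠ x' → y ≠ y' → AlphaVar ρ x y → AlphaVar ((x', y') :: ρ) x y

/-- Alpha-equivalence under the binders listed in `ρ`. -/
inductive AlphaRel : List (Var × Var) → Term → Term → Prop
  | var (ρ : List (Var × Var)) (x y : Var) :
      AlphaVar ρ x y → AlphaRel ρ (.var x) (.var y)
  | lam (ρ : List (Var × Var)) (x y : Var) (t t' : Term) :
      AlphaRel ((x, y) :: ρ) t t' → AlphaRel ρ (.lam x t) (.lam y t')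
  | app (ρ : List (Var × Var)) (v v' u u' : Term) :
      AlphaRel ρ v v' → AlphaRel ρ u u' → AlphaRel ρ (.app v u) (.app v' u')

/-- Alpha-equivalence of terms. -/
def AlphaEq (t t' : Term) : Prop := AlphaRel [] t t'

/-! ### Semantics -/

/-- The interpretation of `t` with respect to the variables `x 0, …, x (m - 1)`, a subset of
`Mfin(D)^m × D`. If a variable is listed several times, its last occurrence is the relevant one
(an inner binder hides an outer one); for distinct variables this plays no role. -/
def interp {A : Type u} : (t : Term) → {m : ℕ} → (x : Fin m → Var) →
    Set ((Fin m → Multiset (Pt A)) × Pt A)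
  | .var y, _, x => {p | ∃ j, x j = y ∧ (∀ i, j < i → x i ≠ y) ∧ p.1 = Pi.single j {p.2}}
  | .lam y t, m, x => {p | ∃ (b : Multiset (Pt A)) (α : Pt A),
      ((Fin.snoc p.1 b : Fin (m + 1) → Multiset (Pt A)), α)
        ∈ interp t (Fin.snoc x y : Fin (m + 1) → Var) ∧
      p.2 = Pt.arrow b α}
  | .app v w, m, x => {p | ∃ (n : ℕ) (α : Fin n → Pt A)
        (a : Fin (n + 1) → Fin m → Multiset (Pt A)),
      (a 0, Pt.arrow (Multiset.ofList (List.ofFn α)) p.2) ∈ interp v x ∧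
      (∀ i : Fin n, (a i.succ, α i) ∈ interp w x) ∧
      p.1 = ∑ i, a i}

/-- The interpretation of a closed term, a subset of `D`. -/
def sem {A : Type u} (t : Term) : Set (Pt A) :=
  {α | ((Fin.elim0 : Fin 0 → Multiset (Pt A)), α) ∈ interp t (Fin.elim0 : Fin 0 → Var)}

/-! ### The two machines -/

/-- Environments: finite partial maps from variables to closures, where a closure is a pair
of a term and an environment; `bind x t e' e` is `{(x, (t, e'))} ∪ e`. -/
inductive Env : Type
  | empty
  | bind (x : Var) (t : Term) (e' : Env) (e : Env)

/-- Closures. -/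
abbrev Closure : Type := Term × Env

/-- States: non-empty stacks, given by their first closure and the remaining stack. -/
abbrev State : Type := Closure × List Closure

/-- The value of an environment at a variable, `none` outside its domain. -/
def Env.lookup : Env → Var → Option Closure
  | .empty, _ => none
  | .bind x t e' e, y => if y = x then some (t, e') else e.lookup y

/-- The variables of the domain of an environment are replaced by the (recursively unfolded)
terms of their closures. -/
def Env.toSubst : Env → Var → Term
  | .empty, y => .var y
  | .bind x t e' e, y => if y = x then t.subst e'.toSubst else e.toSubst y

/-- The term `t[e]` denoted by a closure `(t, e)`. -/
def Closure.toTerm (c : Closure) : Term := c.1.subst c.2.toSubst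

/-- All the closures stored in an environment respect the variable convention. -/
def Env.Conv : Env → Prop
  | .empty => True
  | .bind _ t e' e => (t.Conv ∧ e'.Conv ∧ ∀ y ∈ t.binders, e'.lookup y = none) ∧ e.Conv

/-- A closure `(t, e)` respects the variable convention if so do `t` and the closures in `e`,
and if no variable of the domain of `e` is bound in `t`. -/
def Closure.Conv (c : Closure) : Prop :=
  c.1.Conv ∧ c.2.Conv ∧ ∀ y ∈ c.1.binders, c.2.lookup y = none

/-- The set `𝕊` of the states that respect the variable convention. -/
def State.Conv (s : State) : Prop := Closure.Conv s.1 ∧ ∀ c ∈ s.2, Closure.Conv c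

/-- The initial state `(t, ∅).ε`. -/
def State.init (t : Term) : State := ((t, .empty), [])

/-- The partial transition map on states. -/
def stepS : State → Option State
  | ((.var x, e), π) => (e.lookup x).map fun c => (c, π)
  | ((.lam x u, e), c :: π) => some ((u, .bind x c.1 c.2 e), π)
  | ((.lam _ _, _), []) => none
  | ((.app v u, e), π) => some ((v, e), (u, e) :: π)

mutual

/-- The set `ℋ`: a head variable applied to arguments which are terms or elements of `𝒦`. -/
inductive Head : Type
  | var (x : Var)
  | appTerm (h : Head) (u : Term)
  | appCfg (h : Head) (k : Cfg)

/-- The set `𝒦` of configurations: states, elements of `ℋ`, and abstractions `λ y. k`. -/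
inductive Cfg : Type
  | state (s : State)
  | head (h : Head)
  | lam (y : Var) (k : Cfg)

end

/-- The partial map `≻_h` (machine computing the principal head normal form). -/
def stepH : Cfg → Option Cfg
  | .state s =>
    match stepS s with
    | some s' => some (.state s')
    | none =>
      match s with
      | ((.var x, _), π) =>
          some (.head (π.foldl (fun h c => .appTerm h (Closure.toTerm c)) (.var x)))
      | ((.lam x u, e), _) => some (.lam x (.state ((u, e), [])))
      | ((.app _ _, _), _) => none -- does not occur, as `stepS s` is defined
  | .head _ => none
  | .lam y k => (stepH k).map (.lam y)

mutual

/-- The partial map `≻_β` on `ℋ`: the arguments that are configurations are executed from left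
to right. -/
def stepBetaHead : Head → Option Head
  | .var _ => none
  | .appTerm h u => (stepBetaHead h).map fun h' => .appTerm h' u
  | .appCfg h k =>
    match stepBetaHead h with
    | some h' => some (.appCfg h' k)
    | none => (stepBeta k).map fun k' => .appCfg h k'

/-- The partial map `≻_β` (machine computing the beta-normal form). -/
def stepBeta : Cfg → Option Cfg
  | .state s =>
    match stepS s with
    | some s' => some (.state s')
    | none =>
      match s with
      | ((.var x, _), π) =>
          some (.head (π.foldl (fun h c => .appCfg h (.state (c, []))) (.var x)))
      | ((.lam x u, e), _) => some (.lam x (.state ((u, e), [])))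
      | ((.app _ _, _), _) => none -- does not occur, as `stepS s` is defined
  | .head h => (stepBetaHead h).map .head
  | .lam y k => (stepBeta k).map (.lam y)

end

/-- `HaltsIn step k n`: `n` steps lead from `k` to a configuration where `step` is undefined. -/
inductive HaltsIn (step : Cfg → Option Cfg) : Cfg → ℕ → Prop
  | done (k : Cfg) : step k = none → HaltsIn step k 0
  | next (k k' : Cfg) (n : ℕ) : step k = some k' → HaltsIn step k' n → HaltsIn step k (n + 1)

/-- The number of steps is unique. -/
theorem HaltsIn.unique {step : Cfg → Option Cfg} {k : Cfg} {n n' : ℕ}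
    (h : HaltsIn step k n) (h' : HaltsIn step k n') : n = n' := by
  induction h generalizing n' with
  | done k hk =>
    cases h' with
    | done => rfl
    | next _ k' n hk' _ => rw [hk] at hk'; exact absurd hk' (by simp)
  | next k k' n hk _ ih =>
    cases h' with
    | done _ hk' => rw [hk] at hk'; exact absurd hk' (by simp)
    | next _ k'' n'' hk' h'' =>
      rw [hk] at hk'
      obtain rfl := Option.some.inj hk'
      rw [ih h'']

/-- The number of steps of the execution of `k`: the unique `n` with `HaltsIn step k n` if there
is one, and `∞` otherwise. -/
noncomputable def runLength (step : Cfg → Option Cfg) (k : Cfg) : ℕ∞ :=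
  ⨅ (n : ℕ) (_ : HaltsIn step k n), (n : ℕ∞)

/-- The length `l_h`. -/
noncomputable def lengthH (k : Cfg) : ℕ∞ := runLength stepH k

/-- The length `l_β`. -/
noncomputable def lengthBeta (k : Cfg) : ℕ∞ := runLength stepBeta k

/-- The transition map preserves the variable convention, so that it is a partial map on `𝕊`. -/
theorem State.Conv.step {s s' : State} (hs : s.Conv) (h : stepS s = some s') : s'.Conv := by
  have key : ∀ (e : Env) (x : Var) (c : Closure), e.Conv → e.lookup x = some c → c.Conv := by
    intro e
    induction e with
    | empty => intro x c _ h; simp [Env.lookup] at h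
    | bind y t e' e _ ih =>
      intro x c he h
      simp only [Env.lookup] at h
      split at h
      · obtain rfl := Option.some.inj h
        exact he.1
      · exact ih x c he.2 h
  obtain ⟨⟨t, e⟩, π⟩ := s
  obtain ⟨⟨ht, he, hd⟩, hπ⟩ := hs
  cases t with
  | var x =>
    simp only [stepS, Option.map_eq_some_iff] at h
    obtain ⟨c, hc, rfl⟩ := h
    exact ⟨key e x c he hc, hπ⟩
  | app v u =>
    obtain rfl := Option.some.inj h
    simp only [Term.Conv, Term.binders, List.mem_append, List.nodup_append] at ht hd
    refine ⟨⟨ht.1, he, fun y hy => hd y (Or.inl hy)⟩, ?_⟩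
    intro c hc
    rcases List.mem_cons.1 hc with rfl | hc
    · exact ⟨ht.2.1, he, fun y hy => hd y (Or.inr hy)⟩
    · exact hπ c hc
  | lam x u =>
    cases π with
    | nil => simp [stepS] at h
    | cons c π =>
      obtain rfl := Option.some.inj h
      simp only [Term.Conv, Term.binders, List.nodup_cons, List.mem_cons] at ht hd
      refine ⟨⟨ht.2, ⟨hπ c (by simp), he⟩, ?_⟩, fun c' hc' => hπ c' (by simp [hc'])⟩
      intro y hy
      have hyx : y ≠ x := fun h => ht.1 (h ▸ hy)
      simp only [Env.lookup, if_neg hyx]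
      exact hd y (Or.inr hy)

end ExecTime

open ExecTime

-- The relational semantics is read as a non-idempotent intersection type system: points are types,
-- and a point of the interpretation of a term yields a derivation whose number of rules can be
-- counted. Typing is extended to environments, stacks and states, the weight of a state being the
-- total size of the derivations it stores. Types are used linearly, so duplicating an environment
-- splits its weight, and each transition of `stepS` removes exactly one rule (`State.Typed.step`).
-- Weight therefore bounds running time.
--
-- The parameter `p` restricts the types of free variables. For the head machine `p` is trivial. For
-- the machine computing the normal form it is `Pt.CoEx`, with a result type in `Pt.Ex`: a head
-- variable then has a type with no empty multiset in argument position, so every argument carries a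
-- derivation, again of a type in `Pt.Ex`, that pays for its execution.
--
-- It remains to bound derivations by points. `exists_typed_of_interp` shows that a point of a
-- closed normal term has a derivation of size at most the size of the point. This gives at most
-- `aux(a) + |α| + 1` rules for `v`, where `aux(a)` is the sum of `aux` over `a`, at most `|a|` for
-- the copies of `u`, and one for the application. By `interp_balance`, `aux` and `size` agree on
-- the points of a closed term, so `aux(a) = |a|`, whence the bound.

namespace ExecTime

variable {A : Type*}

/-! ### Multisets of judgements -/

/-- `Bag R c s`: the elements of `s` satisfy `R` with respect to weights of sum `c`. -/
inductive Bag {C P : Type*} [AddCommMonoid C] (R : C → P → Prop) : C → Multiset P → Prop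
  | nil : Bag R 0 0
  | cons (c d : C) (β : P) (s : Multiset P) : R c β → Bag R d s → Bag R (c + d) (β ::ₘ s)

namespace Bag

variable {C P : Type*} [AddCommMonoid C] {R : C → P → Prop}

theorem zero_inv {c : C} (h : Bag R c 0) : c = 0 := by
  generalize hs : (0 : Multiset P) = s at h
  cases h with
  | nil => rfl
  | cons c d β s => exact absurd hs.symm (Multiset.cons_ne_zero)

/-- The order in which a bag was built is invisible in the multiset, so any element can be brought
to the front; commutativity of the weights makes this harmless. -/
theorem cons_inv {c : C} {β : P} {s : Multiset P} (h : Bag R c (β ::ₘ s)) :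
    ∃ c₁ c₂, R c₁ β ∧ Bag R c₂ s ∧ c = c₁ + c₂ := by
  generalize hs : β ::ₘ s = s' at h
  induction h generalizing s with
  | nil => exact absurd hs (Multiset.cons_ne_zero)
  | cons c d γ s' hγ hs' ih =>
    rcases Multiset.cons_eq_cons.1 hs with ⟨rfl, rfl⟩ | ⟨-, r, rfl, rfl⟩
    · exact ⟨c, d, hγ, hs', rfl⟩
    · obtain ⟨c₁, c₂, h₁, h₂, rfl⟩ := ih rfl
      exact ⟨c₁, c + c₂, h₁, .cons _ _ _ _ hγ h₂, add_left_comm _ _ _⟩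

theorem singleton_inv {c : C} {β : P} (h : Bag R c {β}) : R c β := by
  obtain ⟨c₁, c₂, h₁, h₂, rfl⟩ := cons_inv (s := 0) h
  rwa [zero_inv h₂, add_zero]

theorem add_inv {c : C} {s t : Multiset P} (h : Bag R c (s + t)) :
    ∃ c₁ c₂, Bag R c₁ s ∧ Bag R c₂ t ∧ c = c₁ + c₂ := by
  induction s using Multiset.induction generalizing c with
  | empty => exact ⟨0, c, .nil, by simpa using h, (zero_add c).symm⟩
  | cons β s ih =>
    rw [Multiset.cons_add] at h
    obtain ⟨c₁, c₂, h₁, h₂, rfl⟩ := cons_inv h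
    obtain ⟨d₁, d₂, h₃, h₄, rfl⟩ := ih h₂
    exact ⟨c₁ + d₁, d₂, .cons _ _ _ _ h₁ h₃, h₄, (add_assoc _ _ _).symm⟩

theorem ofFn {n : ℕ} {c : Fin n → C} {α : Fin n → P} (h : ∀ i, R (c i) (α i)) :
    Bag R (∑ i, c i) (Multiset.ofList (List.ofFn α)) := by
  induction n with
  | zero => simpa using Bag.nil
  | succ n ih =>
    rw [Fin.sum_univ_succ, List.ofFn_succ, ← Multiset.cons_coe]
    exact .cons _ _ _ _ (h 0) (ih fun i => h i.succ)

end Bag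

/-! ### Sized typing derivations -/

/-- Typing contexts. -/
abbrev Ctx (A : Type*) : Type _ := Var → Multiset (Pt A)

/-- `t.Typed (Γ, n) α`: the judgement `Γ ⊢ t : α` has a derivation with `n` rules. -/
def Term.Typed : Term → Ctx A × ℕ → Pt A → Prop
  | .var x, c, α => c = (Pi.single x {α}, 1)
  | .lam x t, c, τ => ∃ (b : Multiset (Pt A)) (α : Pt A) (n : ℕ), c.1 x = 0 ∧ c.2 = n + 1 ∧
      τ = Pt.arrow b α ∧ Term.Typed t (Function.update c.1 x b, n) α
  | .app v u, c, α => ∃ (c₀ c₁ : Ctx A × ℕ) (s : Multiset (Pt A)),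
      Term.Typed v c₀ (Pt.arrow s α) ∧ Bag (Term.Typed u) c₁ s ∧ c = c₀ + c₁ + (0, 1)

/-- `e.Typed p Γ n`: the environment `e` provides the context `Γ` up to types of its free variables
that satisfy `p`, and `n` is the total size of the derivations for the closures of `e`. -/
def Env.Typed (p : Pt A → Prop) : Env → Ctx A → ℕ → Prop
  | .empty, Γ, n => (∀ x, ∀ β ∈ Γ x, p β) ∧ n = 0
  | .bind x t e' e, Γ, n => ∃ n₁ n₂,
      Bag (fun k β => ∃ Δ k₁ k₂, t.Typed (Δ, k₁) β ∧ Env.Typed p e' Δ k₂ ∧ k = k₁ + k₂) n₁ (Γ x) ∧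
      Env.Typed p e (Function.update Γ x 0) n₂ ∧ n = n₁ + n₂

/-- Sized typing of closures. -/
def Closure.Typed (p : Pt A → Prop) (c : Closure) (n : ℕ) (α : Pt A) : Prop :=
  ∃ Γ n₁ n₂, c.1.Typed (Γ, n₁) α ∧ c.2.Typed p Γ n₂ ∧ n = n₁ + n₂

/-- `StackTyped p π τ α n`: a term of type `τ` applied to the stack `π` has type `α`. -/
def StackTyped (p : Pt A → Prop) : List Closure → Pt A → Pt A → ℕ → Prop
  | [], τ, α, n => τ = α ∧ n = 0
  | c :: π, τ, α, n => ∃ s τ' n₁ n₂, τ = Pt.arrow s τ' ∧ Bag (Closure.Typed p c) n₁ s ∧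
      StackTyped p π τ' α n₂ ∧ n = n₁ + n₂

/-- Sized typing of states. -/
def State.Typed (p : Pt A → Prop) (s : State) (α : Pt A) (n : ℕ) : Prop :=
  ∃ τ n₁ n₂, Closure.Typed p s.1 n₁ τ ∧ StackTyped p s.2 τ α n₂ ∧ n = n₁ + n₂

variable {p : Pt A → Prop}

/-- There is no weakening: closures from which nothing is demanded carry no weight. This keeps the
count exact. -/
theorem Env.Typed.zero_inv {e : Env} {n : ℕ} (h : e.Typed p 0 n) : n = 0 := by
  induction e generalizing n with
  | empty => exact h.2
  | bind x t e' e _ ih =>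
    obtain ⟨n₁, n₂, h₁, h₂, rfl⟩ := h
    rw [Function.update_zero] at h₂
    rw [h₁.zero_inv, ih h₂]

theorem update_add_zero (Γ Δ : Ctx A) (x : Var) :
    Function.update (Γ + Δ) x 0 = Function.update Γ x 0 + Function.update Δ x 0 := by
  rw [← Function.update_add, add_zero]

/-- Linearity of resources: an environment copied by the application transition shares its weight
between the two copies. -/
theorem Env.Typed.add_inv {e : Env} {Γ Δ : Ctx A} {n : ℕ} (h : e.Typed p (Γ + Δ) n) :
    ∃ n₁ n₂, e.Typed p Γ n₁ ∧ e.Typed p Δ n₂ ∧ n = n₁ + n₂ := by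
  induction e generalizing Γ Δ n with
  | empty =>
    exact ⟨0, 0, ⟨fun x β hβ => h.1 x β (Multiset.mem_add.2 (.inl hβ)), rfl⟩,
      ⟨fun x β hβ => h.1 x β (Multiset.mem_add.2 (.inr hβ)), rfl⟩, h.2⟩
  | bind x t e' e _ ih =>
    obtain ⟨n₁, n₂, h₁, h₂, rfl⟩ := h
    obtain ⟨k₁, k₂, h₃, h₄, rfl⟩ := Bag.add_inv h₁
    rw [update_add_zero] at h₂
    obtain ⟨l₁, l₂, h₅, h₆, rfl⟩ := ih h₂
    exact ⟨k₁ + l₁, k₂ + l₂, ⟨_, _, h₃, h₅, rfl⟩, ⟨_, _, h₄, h₆, rfl⟩, add_add_add_comm _ _ _ _⟩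

/-- Each derivation for `u` receives the share of the environment that its own context demands. -/
theorem Env.Typed.bag {e : Env} {u : Term} {c : Ctx A × ℕ} {s : Multiset (Pt A)} {n : ℕ}
    (hu : Bag (Term.Typed u) c s) (h : e.Typed p c.1 n) :
    Bag (Closure.Typed p (u, e)) (c.2 + n) s := by
  induction hu generalizing n with
  | nil =>
    have h' : e.Typed p 0 n := h
    rw [h'.zero_inv]
    exact .nil
  | cons c d β s hβ _ ih =>
    obtain ⟨n₁, n₂, h₁, h₂, rfl⟩ := Env.Typed.add_inv h
    rw [Prod.snd_add, add_add_add_comm]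
    exact .cons _ _ _ _ ⟨_, _, _, hβ, h₁, rfl⟩ (ih h₂)

/-- A context can be extended at a variable that the environment leaves free. -/
theorem Env.Typed.update {e : Env} {Γ : Ctx A} {x : Var} {b : Multiset (Pt A)} {n : ℕ}
    (h : e.Typed p Γ n) (hx : e.lookup x = none) (hb : ∀ β ∈ b, p β) :
    e.Typed p (Function.update Γ x b) n := by
  induction e generalizing Γ n with
  | empty =>
    refine ⟨fun y β hβ => ?_, h.2⟩
    by_cases hy : y = x
    · subst hy
      rw [Function.update_self] at hβ
      exact hb β hβ
    · rw [Function.update_of_ne hy] at hβ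
      exact h.1 y β hβ
  | bind y t e' e _ ih =>
    obtain ⟨n₁, n₂, h₁, h₂, rfl⟩ := h
    simp only [Env.lookup] at hx
    split at hx
    · exact absurd hx (Option.some_ne_none _)
    · rename_i hxy
      refine ⟨n₁, n₂, ?_, ?_, rfl⟩
      · rwa [Function.update_of_ne (Ne.symm hxy)]
      · rw [Function.update_comm hxy]
        exact ih h₂ hx

theorem Env.Typed.of_lookup_eq_none {e : Env} {Γ : Ctx A} {x : Var} {n : ℕ}
    (h : e.Typed p Γ n) (hx : e.lookup x = none) : ∀ β ∈ Γ x, p β := by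
  induction e generalizing Γ n with
  | empty => exact h.1 x
  | bind y t e' e _ ih =>
    obtain ⟨n₁, n₂, h₁, h₂, rfl⟩ := h
    simp only [Env.lookup] at hx
    split at hx
    · exact absurd hx (Option.some_ne_none _)
    · rename_i hxy
      have := ih h₂ hx
      rwa [Function.update_of_ne hxy] at this

/-- The context demands one type, at `x` only, so the whole weight of the environment sits in the
closure that is fetched. -/
theorem Env.Typed.of_lookup_eq_some {e : Env} {x : Var} {τ : Pt A} {n : ℕ} {c : Closure}
    (h : e.Typed p (Pi.single x {τ}) n) (hx : e.lookup x = some c) :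
    Closure.Typed p c n τ := by
  induction e generalizing n with
  | empty => simp [Env.lookup] at hx
  | bind y t e' e _ ih =>
    obtain ⟨n₁, n₂, h₁, h₂, rfl⟩ := h
    simp only [Env.lookup] at hx
    split at hx
    · rename_i hxy
      subst hxy
      obtain rfl := Option.some.inj hx
      rw [Pi.single_eq_same] at h₁
      rw [Pi.single, Function.update_idem, Function.update_zero] at h₂
      rw [h₂.zero_inv]
      exact h₁.singleton_inv
    · rename_i hxy
      rw [Pi.single_eq_of_ne (Ne.symm hxy)] at h₁
      rw [Function.update_eq_self_iff.2 (Pi.single_eq_of_ne (Ne.symm hxy) _).symm] at h₂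
      rw [h₁.zero_inv, zero_add]
      exact ih h₂ hx

/-! ### Subject reduction -/

/-- A variable transition consumes an axiom, an application transition an application rule, a popped
abstraction an abstraction rule; everything else is only redistributed. -/
theorem State.Typed.step {s s' : State} {α : Pt A} {n : ℕ} (h : s.Typed p α n)
    (hs : stepS s = some s') : ∃ n', n = n' + 1 ∧ s'.Typed p α n' := by
  obtain ⟨⟨t, e⟩, π⟩ := s
  obtain ⟨τ, _, n₂, ⟨Γ, k₁, k₂, ht, he, rfl⟩, hπ, rfl⟩ := h
  cases t with
  | var x =>
    simp only [stepS, Option.map_eq_some_iff] at hs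
    obtain ⟨c, hc, rfl⟩ := hs
    obtain ⟨rfl, rfl⟩ := Prod.mk.inj ht
    exact ⟨k₂ + n₂, by omega, τ, k₂, n₂, he.of_lookup_eq_some hc, hπ, rfl⟩
  | app v u =>
    obtain rfl := Option.some.inj hs
    obtain ⟨⟨Γ₀, m₀⟩, ⟨Γ₁, m₁⟩, s, hv, hu, hc⟩ := ht
    obtain ⟨rfl, rfl⟩ := Prod.mk.inj hc
    have he' : e.Typed p (Γ₀ + Γ₁) k₂ := by simpa using he
    obtain ⟨l₀, l₁, he₀, he₁, rfl⟩ := he'.add_inv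
    refine ⟨(m₀ + l₀) + ((m₁ + l₁) + n₂), by simp only [Prod.mk_add_mk]; omega,
      _, _, _, ⟨_, _, _, hv, he₀, rfl⟩, ⟨s, τ, _, _, rfl, Env.Typed.bag hu he₁, hπ, rfl⟩, rfl⟩
  | lam x w =>
    cases π with
    | nil => simp [stepS] at hs
    | cons c π =>
      obtain rfl := Option.some.inj hs
      obtain ⟨b, σ, m, hx, rfl, rfl, hw⟩ := ht
      obtain ⟨s, τ', l₁, l₂, hτ, hc, hπ, rfl⟩ := hπ
      obtain ⟨rfl, rfl⟩ := Pt.arrow_injective hτ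
      refine ⟨(m + (l₁ + k₂)) + l₂, by omega, σ, _, _, ⟨_, _, _, hw, ⟨l₁, k₂, ?_, ?_, rfl⟩, rfl⟩,
        hπ, rfl⟩
      · rw [Function.update_self]
        exact hc
      -- The abstraction rule requires `Γ x = 0`, so resetting `x` to `0` gives back `Γ`, for which
      -- `e` is already typed.
      · rw [Function.update_idem, Function.update_eq_self_iff.2 hx.symm]
        exact he

/-- Below an abstraction that is not applied. -/
theorem State.Typed.lam {x : Var} {w : Term} {e : Env} {τ : Pt A} {n : ℕ}
    (h : State.Typed p ((Term.lam x w, e), []) τ n) (hx : e.lookup x = none)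
    (hp : ∀ b α, τ = Pt.arrow b α → ∀ β ∈ b, p β) :
    ∃ b α n', τ = Pt.arrow b α ∧ n = n' + 1 ∧ State.Typed p ((w, e), []) α n' := by
  obtain ⟨_, _, n₂, ⟨Γ, k₁, k₂, ⟨b, α, m, -, rfl, rfl, hw⟩, he, rfl⟩, ⟨rfl, rfl⟩, rfl⟩ := h
  exact ⟨b, α, m + k₂, rfl, by omega, α, _, _,
    ⟨_, _, _, hw, he.update hx (hp b α rfl), rfl⟩, ⟨rfl, rfl⟩, rfl⟩

theorem State.Typed.var {x : Var} {e : Env} {π : List Closure} {α : Pt A} {n : ℕ}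
    (h : State.Typed p ((Term.var x, e), π) α n) (hx : e.lookup x = none) :
    ∃ τ n', p τ ∧ StackTyped p π τ α n' ∧ n' + 1 ≤ n := by
  obtain ⟨τ, _, n₂, ⟨Γ, k₁, k₂, ht, he, rfl⟩, hπ, rfl⟩ := h
  obtain ⟨rfl, rfl⟩ := Prod.mk.inj ht
  exact ⟨τ, n₂, he.of_lookup_eq_none hx τ (by simp), hπ, by omega⟩

/-- This is where the variable convention matters: under an unapplied abstraction the bound variable
becomes free, and the environment must not give it a value. -/
theorem State.Conv.lam {x : Var} {w : Term} {e : Env} {π : List Closure}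
    (h : State.Conv ((Term.lam x w, e), π)) :
    e.lookup x = none ∧ State.Conv ((w, e), []) := by
  obtain ⟨⟨hw, he, hd⟩, -⟩ := h
  exact ⟨hd x (by simp [Term.binders]), ⟨(List.nodup_cons.1 hw).2, he,
    fun y hy => hd y (List.mem_cons_of_mem _ hy)⟩, by simp⟩

/-! ### Termination of the two machines -/

theorem HaltsIn.lamH {k : Cfg} {n : ℕ} (h : HaltsIn stepH k n) (x : Var) :
    HaltsIn stepH (.lam x k) n := by
  induction h with
  | done k hk => exact .done _ (by simp [stepH, hk])
  | next k k' n hk _ ih => exact .next _ _ _ (by simp [stepH, hk]) ih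

theorem HaltsIn.lamBeta {k : Cfg} {n : ℕ} (h : HaltsIn stepBeta k n) (x : Var) :
    HaltsIn stepBeta (.lam x k) n := by
  induction h with
  | done k hk => exact .done _ (by simp [stepBeta, hk])
  | next k k' n hk _ ih => exact .next _ _ _ (by simp [stepBeta, hk]) ih

/-- Execution is from left to right: the run of `h` is exhausted before that of `k` starts, so the
lengths add. -/
theorem HaltsIn.appCfg {h : Head} {k : Cfg} {i j : ℕ} (hi : HaltsIn stepBeta (.head h) i)
    (hj : HaltsIn stepBeta k j) : HaltsIn stepBeta (.head (.appCfg h k)) (i + j) := by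
  generalize hc : Cfg.head h = c at hi
  induction hi generalizing h with
  | done c hn =>
    subst hc
    simp only [stepBeta, Option.map_eq_none_iff] at hn
    rw [zero_add]
    induction hj with
    | done k hk => exact .done _ (by simp [stepBeta, stepBetaHead, hn, hk])
    | next k k' n hk _ ih =>
      exact .next _ _ _ (by simp [stepBeta, stepBetaHead, hn, hk]) ih
  | next c c' n hn _ ih =>
    subst hc
    simp only [stepBeta, Option.map_eq_some_iff] at hn
    obtain ⟨h', hh, rfl⟩ := hn
    rw [Nat.add_right_comm]
    exact .next _ _ _ (by simp only [stepBeta, stepBetaHead, hh, Option.map_some]) (ih rfl)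

theorem State.Typed.haltsIn_stepH {s : State} {α : Pt A} {n : ℕ}
    (h : s.Typed (fun _ => True) α n) (hs : s.Conv) :
    ∃ k ≤ n, HaltsIn stepH (.state s) k := by
  induction n generalizing s α with
  -- No typed state has weight `0`: its subject ends in at least one rule.
  | zero =>
    obtain ⟨⟨t, e⟩, π⟩ := s
    cases hstep : stepS ((t, e), π) with
    | some s' =>
      obtain ⟨n', h0, -⟩ := h.step hstep
      omega
    | none =>
      cases t with
      | var x =>
        simp only [stepS, Option.map_eq_none_iff] at hstep
        obtain ⟨τ, n', -, -, h0⟩ := h.var hstep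
        omega
      | app v u => simp [stepS] at hstep
      | lam x w =>
        cases π with
        | cons c π => simp [stepS] at hstep
        | nil =>
          obtain ⟨b, β, n', -, h0, -⟩ := h.lam hs.lam.1 (by simp)
          omega
  | succ n ih =>
    obtain ⟨⟨t, e⟩, π⟩ := s
    cases hstep : stepS ((t, e), π) with
    | some s' =>
      obtain ⟨n', h0, h'⟩ := h.step hstep
      obtain rfl : n = n' := by omega
      obtain ⟨k, hk, hk'⟩ := ih h' (hs.step hstep)
      exact ⟨k + 1, by omega, .next _ _ _ (by simp [stepH, hstep]) hk'⟩
    | none =>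
      cases t with
      | var x =>
        exact ⟨1, by omega, .next _ _ _ (by simp only [stepH, hstep]; rfl) (.done _ (by simp [stepH]))⟩
      | app v u => simp [stepS] at hstep
      | lam x w =>
        cases π with
        | cons c π => simp [stepS] at hstep
        | nil =>
          obtain ⟨b, β, n', -, h0, h'⟩ := h.lam hs.lam.1 (by simp)
          obtain rfl : n = n' := by omega
          obtain ⟨k, hk, hk'⟩ := ih h' hs.lam.2
          exact ⟨k + 1, by omega, .next _ _ _ (by simp only [stepH, hstep]) (hk'.lamH x)⟩

theorem Pt.Ex.arrow_inv {b : Multiset (Pt A)} {α : Pt A} (h : Pt.Ex (Pt.arrow b α)) :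
    (∀ β ∈ b, Pt.CoEx β) ∧ Pt.Ex α := by
  generalize hτ : Pt.arrow b α = τ at h
  cases h with
  | atom c => exact absurd hτ.symm Pt.atom_ne_arrow
  | arrow b' α' hb hα =>
    obtain ⟨rfl, rfl⟩ := Pt.arrow_injective hτ
    exact ⟨hb, hα⟩

theorem Pt.CoEx.arrow_inv {b : Multiset (Pt A)} {α : Pt A} (h : Pt.CoEx (Pt.arrow b α)) :
    b ≠ 0 ∧ (∀ β ∈ b, Pt.Ex β) ∧ Pt.CoEx α := by
  generalize hτ : Pt.arrow b α = τ at h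
  cases h with
  | atom c => exact absurd hτ.symm Pt.atom_ne_arrow
  | arrow b' α' h0 hb hα =>
    obtain ⟨rfl, rfl⟩ := Pt.arrow_injective hτ
    exact ⟨h0, hb, hα⟩

/-- Execution of the arguments of a head variable of co-exhaustive type. -/
theorem StackTyped.haltsIn_stepBeta {π : List Closure} {τ α : Pt A} {n i : ℕ} {h : Head}
    (hπ : StackTyped Pt.CoEx π τ α n) (hτ : Pt.CoEx τ)
    (ih : ∀ c ∈ π, ∀ m ≤ n, ∀ β : Pt A, Pt.Ex β → Closure.Typed Pt.CoEx c m β →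
      ∃ k ≤ m, HaltsIn stepBeta (.state (c, [])) k)
    (hh : HaltsIn stepBeta (.head h) i) :
    ∃ k ≤ i + n,
      HaltsIn stepBeta (.head (π.foldl (fun h c => .appCfg h (.state (c, []))) h)) k := by
  induction π generalizing τ n i h with
  | nil => exact ⟨i, by omega, hh⟩
  | cons c π ihπ =>
    obtain ⟨s, τ', n₁, n₂, rfl, hc, hπ, rfl⟩ := hπ
    obtain ⟨hs, hsE, hτ'⟩ := hτ.arrow_inv
    -- An argument is executed once, so a single type of it suffices; nonemptiness of `s`, from
    -- `Pt.CoEx`, provides one, and the weight of the others is wasted.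
    obtain ⟨β, hβ⟩ := Multiset.exists_mem_of_ne_zero hs
    obtain ⟨r, rfl⟩ := Multiset.exists_cons_of_mem hβ
    obtain ⟨m₁, m₂, hm, -, rfl⟩ := hc.cons_inv
    obtain ⟨j, hj, hj'⟩ := ih c (by simp) m₁ (by omega) β (hsE β hβ) hm
    obtain ⟨k, hk, hk'⟩ := ihπ hπ hτ'
      (fun c' hc' m hm => ih c' (List.mem_cons_of_mem _ hc') m (by omega)) (hh.appCfg hj')
    exact ⟨k, by omega, hk'⟩

theorem State.Typed.haltsIn_stepBeta {s : State} {α : Pt A} {n : ℕ}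
    (h : s.Typed Pt.CoEx α n) (hα : Pt.Ex α) (hs : s.Conv) :
    ∃ k ≤ n, HaltsIn stepBeta (.state s) k := by
  -- Strong induction, because the arguments of a head variable have arbitrary smaller weights.
  induction n using Nat.strong_induction_on generalizing s α with
  | _ n ih =>
    obtain ⟨⟨t, e⟩, π⟩ := s
    cases hstep : stepS ((t, e), π) with
    | some s' =>
      obtain ⟨n', rfl, h'⟩ := h.step hstep
      obtain ⟨k, hk, hk'⟩ := ih n' (by omega) h' hα (hs.step hstep)
      exact ⟨k + 1, by omega, .next _ _ _ (by simp [stepBeta, hstep]) hk'⟩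
    | none =>
      cases t with
      | var x =>
        have hx := hstep
        simp only [stepS, Option.map_eq_none_iff] at hx
        obtain ⟨τ, n', hτ, hπ, hn⟩ := h.var hx
        -- The rule for the head variable pays for exposing it; what is left is the weight of the
        -- stack, which pays for the arguments.
        obtain ⟨k, hk, hk'⟩ := hπ.haltsIn_stepBeta hτ
          (fun c hc m hm β hβ hcβ => ih m (by omega) ⟨β, m, 0, hcβ, ⟨rfl, rfl⟩, rfl⟩ hβ
            ⟨hs.2 c hc, by simp⟩)
          (HaltsIn.done (.head (.var x)) (by simp [stepBeta, stepBetaHead]))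
        exact ⟨k + 1, by omega, .next _ _ _ (by simp only [stepBeta, hstep]) hk'⟩
      | app v u => simp [stepS] at hstep
      | lam x w =>
        cases π with
        | cons c π => simp [stepS] at hstep
        | nil =>
          -- Since the result type is in `Pt.Ex`, the newly freed variable gets only types in
          -- `Pt.CoEx`.
          obtain ⟨b, β, n', rfl, rfl, h'⟩ := h.lam hs.lam.1
            (fun b β hb => by subst hb; exact hα.arrow_inv.1)
          obtain ⟨k, hk, hk'⟩ := ih n' (by omega) h' hα.arrow_inv.2 hs.lam.2
          exact ⟨k + 1, by omega, .next _ _ _ (by simp only [stepBeta, hstep]) (hk'.lamBeta x)⟩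

theorem runLength_le {step : Cfg → Option Cfg} {k : Cfg} {m n : ℕ} (h : HaltsIn step k m)
    (hmn : m ≤ n) : runLength step k ≤ n :=
  (iInf₂_le m h).trans (Nat.cast_le.2 hmn)

/-! ### Invariance under alpha-equivalence -/

theorem AlphaRel.normal {ρ : List (Var × Var)} {t t' : Term} (h : AlphaRel ρ t t')
    (ht : t'.Normal) : t.Normal := by
  induction h with
  | var => trivial
  | lam ρ x y t t' _ ih => exact ih ht
  | app ρ v v' u u' hv _ ihv ihu =>
    refine ⟨ihv ht.1, ihu ht.2.1, ?_⟩
    rintro ⟨x, w, rfl⟩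
    cases hv with
    | lam _ _ y _ w' => exact ht.2.2 ⟨y, w', rfl⟩

/-- The list `ρ` pairs the variables of `x` with those of `x'`, the last ones first. -/
inductive Pairing : List (Var × Var) → {m : ℕ} → (Fin m → Var) → (Fin m → Var) → Prop
  | nil : Pairing [] (Fin.elim0 : Fin 0 → Var) (Fin.elim0 : Fin 0 → Var)
  | snoc (ρ : List (Var × Var)) (m : ℕ) (x x' : Fin m → Var) (y y' : Var) : Pairing ρ x x' →
      Pairing ((y, y') :: ρ) (Fin.snoc x y : Fin (m + 1) → Var) (Fin.snoc x' y' : Fin (m + 1) → Var)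

/-- Both conventions select the innermost binder: the first matching pair of `ρ` is the last
matching position of the sequences. -/
theorem Pairing.var {ρ : List (Var × Var)} {m : ℕ} {x x' : Fin m → Var} (h : Pairing ρ x x')
    {z z' : Var} (hz : AlphaVar ρ z z') {j : Fin m} (hj : x' j = z') (hj' : ∀ i, j < i → x' i ≠ z') :
    x j = z ∧ ∀ i, j < i → x i ≠ z := by
  induction h with
  | nil => exact j.elim0
  | snoc ρ m x x' y y' _ ih =>
    cases hz with
    | here =>
      have : j = Fin.last m := by
        by_contra hne
        exact hj' (Fin.last m) (Fin.lt_last_iff_ne_last.2 hne) (by simp)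
      subst this
      exact ⟨by simp, fun i hi => absurd hi (not_lt.2 (Fin.le_last i))⟩
    | there _ _ _ _ _ hy hy' hz =>
      induction j using Fin.lastCases with
      | last => exact absurd (by simpa using hj.symm) hy'
      | cast j =>
        rw [Fin.snoc_castSucc] at hj ⊢
        obtain ⟨h₁, h₂⟩ := ih hz hj fun i hi => by
          simpa using hj' i.castSucc (Fin.castSucc_lt_castSucc_iff.2 hi)
        refine ⟨h₁, fun i hi => ?_⟩
        induction i using Fin.lastCases with
        | last => simpa using Ne.symm hy
        | cast i => simpa using h₂ i (Fin.castSucc_lt_castSucc_iff.1 hi)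

theorem AlphaRel.interp {ρ : List (Var × Var)} {t t' : Term} (h : AlphaRel ρ t t') {m : ℕ}
    {x x' : Fin m → Var} (hρ : Pairing ρ x x') {q : (Fin m → Multiset (Pt A)) × Pt A}
    (hq : q ∈ interp t' x') : q ∈ interp t x := by
  induction h generalizing m with
  | var ρ z z' hz =>
    obtain ⟨j, hj, hj', hq⟩ := hq
    obtain ⟨h₁, h₂⟩ := hρ.var hz hj hj'
    exact ⟨j, h₁, h₂, hq⟩
  | lam ρ y y' t t' _ ih =>
    obtain ⟨b, α, h₁, h₂⟩ := hq
    exact ⟨b, α, ih (.snoc _ _ _ _ _ _ hρ) h₁, h₂⟩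
  | app ρ v v' u u' _ _ ihv ihu =>
    obtain ⟨n, α, a, h₁, h₂, h₃⟩ := hq
    exact ⟨n, α, a, ihv hρ h₁, fun i => ihu hρ (h₂ i), h₃⟩

/-! ### From the interpretation to derivations -/

/-- The context that gives the types `a j` to the variables `x j`. -/
def ctxOf {m : ℕ} (x : Fin m → Var) : (Fin m → Multiset (Pt A)) →+ Ctx A where
  toFun a := ∑ j, Pi.single (x j) (a j)
  map_zero' := by simp
  map_add' a b := by simp [Pi.single_add, Finset.sum_add_distrib]

theorem ctxOf_apply {m : ℕ} (x : Fin m → Var) (a : Fin m → Multiset (Pt A)) :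
    ctxOf x a = ∑ j, Pi.single (x j) (a j) := rfl

/-- The total weight of a sequence of multisets of points. -/
def weight (f : Pt A → ℕ) (m : ℕ) : (Fin m → Multiset (Pt A)) →+ ℕ where
  toFun a := ∑ j, ((a j).map f).sum
  map_zero' := by simp
  map_add' a b := by simp [Finset.sum_add_distrib]

theorem weight_apply (f : Pt A → ℕ) {m : ℕ} (a : Fin m → Multiset (Pt A)) :
    weight f m a = ∑ j, ((a j).map f).sum := rfl

theorem weight_snoc (f : Pt A → ℕ) {m : ℕ} (a : Fin m → Multiset (Pt A)) (b : Multiset (Pt A)) :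
    weight f (m + 1) (Fin.snoc a b : Fin (m + 1) → Multiset (Pt A))
      = weight f m a + (b.map f).sum := by
  simp [weight_apply, Fin.sum_univ_castSucc]

theorem weight_single (f : Pt A → ℕ) {m : ℕ} (j : Fin m) (α : Pt A) :
    weight f m (Pi.single j {α}) = f α := by
  rw [weight_apply, Finset.sum_eq_single j]
  · simp
  · intro i _ hi
    simp [Pi.single_eq_of_ne hi]
  · simp

/-- A hidden variable gets no type. -/
theorem interp_hidden {t : Term} {m : ℕ} {x : Fin m → Var} {a : Fin m → Multiset (Pt A)} {α : Pt A}
    (h : (a, α) ∈ interp t x) {i j : Fin m} (hij : j < i) (hx : x i = x j) : a j = 0 := by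
  induction t generalizing m α with
  | var y =>
    obtain ⟨k, rfl, hk, hka⟩ := h
    have hka : a = Pi.single k {α} := hka
    rw [hka, Pi.single_eq_of_ne]
    rintro rfl
    exact hk i hij hx
  | lam y t ih =>
    obtain ⟨b, β, h, -⟩ := h
    have := ih h (i := i.castSucc) (j := j.castSucc) (Fin.castSucc_lt_castSucc_iff.2 hij)
      (by simpa using hx)
    simpa using this
  | app v u ihv ihu =>
    obtain ⟨n, β, c, hv, hu, hc⟩ := h
    have hc : a = ∑ i, c i := hc
    rw [hc, Finset.sum_apply, Fin.sum_univ_succ, ihv hv hij hx,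
      Finset.sum_eq_zero fun k _ => ihu (hu k) hij hx, add_zero]

/-- If `y` already occurs in `x`, the new binder hides those positions, which by `interp_hidden`
contribute no type. This is the side condition of the abstraction rule. -/
theorem ctxOf_snoc {t : Term} {m : ℕ} {x : Fin m → Var} {y : Var} {a : Fin m → Multiset (Pt A)}
    {b : Multiset (Pt A)} {α : Pt A}
    (h : ((Fin.snoc a b : Fin (m + 1) → Multiset (Pt A)), α)
      ∈ interp t (Fin.snoc x y : Fin (m + 1) → Var)) :
    ctxOf x a y = 0 ∧
      ctxOf (Fin.snoc x y : Fin (m + 1) → Var) (Fin.snoc a b : Fin (m + 1) → Multiset (Pt A))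
        = Function.update (ctxOf x a) y b := by
  have h0 : ctxOf x a y = 0 := by
    rw [ctxOf_apply, Finset.sum_apply]
    refine Finset.sum_eq_zero fun j _ => ?_
    by_cases hj : x j = y
    · have := interp_hidden h (i := Fin.last m) (j := j.castSucc) (Fin.castSucc_lt_last j)
        (by simpa using hj.symm)
      rw [Fin.snoc_castSucc] at this
      simp [this]
    · exact Pi.single_eq_of_ne (Ne.symm hj) _
  refine ⟨h0, ?_⟩
  have hs : ctxOf (Fin.snoc x y : Fin (m + 1) → Var)
      (Fin.snoc a b : Fin (m + 1) → Multiset (Pt A)) = ctxOf x a + Pi.single y b := by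
    simp [ctxOf_apply, Fin.sum_univ_castSucc]
  rw [hs]
  funext z
  by_cases hz : z = y
  · subst hz
    simp [h0]
  · simp [hz]

theorem sum_ofFn {n : ℕ} (f : Pt A → ℕ) (α : Fin n → Pt A) :
    ((Multiset.ofList (List.ofFn α)).map f).sum = ∑ i, f (α i) := by
  rw [Multiset.map_coe, Multiset.sum_coe, List.map_ofFn, List.sum_ofFn]
  rfl

theorem Pt.one_le_size (α : Pt A) : 1 ≤ α.size := by
  induction α using Pt.induction with
  | atom c => rw [Pt.size_atom]
  | arrow a α _ _ => rw [Pt.size_arrow]; omega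

/-- The difference of the two sizes is the same on both sides of a judgement. -/
theorem interp_balance {t : Term} {m : ℕ} {x : Fin m → Var} {a : Fin m → Multiset (Pt A)} {α : Pt A}
    (h : (a, α) ∈ interp t x) :
    weight Pt.size m a + α.aux = weight Pt.aux m a + α.size := by
  induction t generalizing m α with
  | var y =>
    obtain ⟨k, -, -, hka⟩ := h
    have hka : a = Pi.single k {α} := hka
    rw [hka, weight_single, weight_single, add_comm]
  | lam y t ih =>
    obtain ⟨b, β, h, hα⟩ := h
    replace h : ((Fin.snoc a b : Fin (m + 1) → Multiset (Pt A)), β)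
      ∈ interp t (Fin.snoc x y : Fin (m + 1) → Var) := h
    have hα : α = Pt.arrow b β := hα
    have := ih h
    rw [weight_snoc, weight_snoc] at this
    rw [hα, Pt.size_arrow, Pt.aux_arrow]
    omega
  | app v u ihv ihu =>
    obtain ⟨n, β, c, hv, hu, hc⟩ := h
    have hc : a = ∑ i, c i := hc
    have h₁ := ihv hv
    -- The points of the argument multiset occur to the left of the arrow in `h₁` and as results in
    -- `h₂`, with the roles of `size` and `aux` exchanged; they cancel on addition.
    have h₂ := Finset.sum_congr rfl fun i (_ : i ∈ Finset.univ) => ihu (hu i)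
    rw [Pt.size_arrow, Pt.aux_arrow, sum_ofFn, sum_ofFn] at h₁
    rw [Finset.sum_add_distrib, Finset.sum_add_distrib] at h₂
    rw [hc, map_sum, map_sum, Fin.sum_univ_succ, Fin.sum_univ_succ]
    simp only at h₁
    omega

/-- Points of the interpretation of a term have derivations, whose size is bounded if the term is
normal. -/
theorem exists_typed_of_interp {t : Term} {m : ℕ} {x : Fin m → Var} {a : Fin m → Multiset (Pt A)}
    {α : Pt A} (h : (a, α) ∈ interp t x) (ht : t.Normal) :
    ∃ n, t.Typed (ctxOf x a, n) α ∧ n ≤ weight Pt.aux m a + α.size ∧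
      (¬ t.IsLam → n + α.aux ≤ weight Pt.aux m a + 1) := by
  -- The last clause strengthens the induction. In an application of a normal term the function part
  -- is not an abstraction, so the sizes of the argument points are on the left of its bound and
  -- absorb those allowed by the bounds for the arguments.
  induction t generalizing m α with
  | var y =>
    obtain ⟨k, rfl, -, hka⟩ := h
    have hka : a = Pi.single k {α} := hka
    have := α.one_le_size
    refine ⟨1, ?_, by omega, fun _ => ?_⟩
    · rw [hka]
      change (_, _) = (_, _)
      rw [ctxOf_apply, Finset.sum_eq_single k]
      · simp
      · intro i _ hi
        simp [Pi.single_eq_of_ne hi]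
      · simp
    · rw [hka, weight_single, add_comm]
  | lam y t ih =>
    obtain ⟨b, β, h, hα⟩ := h
    replace h : ((Fin.snoc a b : Fin (m + 1) → Multiset (Pt A)), β)
      ∈ interp t (Fin.snoc x y : Fin (m + 1) → Var) := h
    have hα : α = Pt.arrow b β := hα
    obtain ⟨n, hn, hle, -⟩ := ih h ht
    obtain ⟨h₁, h₂⟩ := ctxOf_snoc h
    rw [h₂] at hn
    rw [weight_snoc] at hle
    refine ⟨n + 1, ⟨b, β, n, h₁, rfl, hα, hn⟩, ?_, fun hl => absurd ⟨y, t, rfl⟩ hl⟩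
    rw [hα, Pt.size_arrow]
    omega
  | app v u ihv ihu =>
    obtain ⟨n, β, c, hv, hu, hc⟩ := h
    have hc : a = ∑ i, c i := hc
    obtain ⟨n₀, hn₀, -, hle⟩ := ihv hv ht.1
    have hle := hle ht.2.2
    choose k hk hkle _ using fun i => ihu (hu i) ht.2.1
    have hsum := Finset.sum_le_sum fun i (_ : i ∈ Finset.univ) => hkle i
    rw [Pt.aux_arrow, sum_ofFn] at hle
    rw [Finset.sum_add_distrib] at hsum
    -- With `1 ≤ |α|`, the sharper bound for terms that are not abstractions implies the general
    -- one.
    have hα := α.one_le_size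
    refine ⟨n₀ + ∑ i, k i + 1, ⟨_, _, _, hn₀, Bag.ofFn hk, ?_⟩, ?_, fun _ => ?_⟩
    · rw [← prod_mk_sum, hc, map_sum, Fin.sum_univ_succ]
      simp
    all_goals
      rw [hc, map_sum, Fin.sum_univ_succ]
      simp only at hle
      omega

theorem exists_typed_of_sem {t : Term} {α : Pt A} (h : α ∈ sem t) (ht : t.Normal) :
    ∃ n ≤ α.size, t.Typed (0, n) α := by
  obtain ⟨n, hn, hle, -⟩ := exists_typed_of_interp h ht
  rw [weight_apply, Fin.sum_univ_zero, zero_add] at hle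
  rw [ctxOf_apply, Fin.sum_univ_zero] at hn
  exact ⟨n, hle, hn⟩

/-- With no variables, both weights in `interp_balance` vanish. -/
theorem aux_eq_size_of_sem {t : Term} {α : Pt A} (h : α ∈ sem t) : α.aux = α.size := by
  have := interp_balance h
  simpa [weight_apply] using this

theorem exists_bag_of_sem {t : Term} {a : Multiset (Pt A)} (h : ∀ β ∈ a, β ∈ sem t)
    (ht : t.Normal) : ∃ n ≤ Pt.msize a, Bag t.Typed ((0 : Ctx A), n) a := by
  induction a using Multiset.induction with
  | empty => exact ⟨0, Nat.zero_le _, .nil⟩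
  | cons β a ih =>
    obtain ⟨n, hn, hb⟩ := ih fun γ hγ => h γ (Multiset.mem_cons_of_mem hγ)
    obtain ⟨k, hk, hk'⟩ := exists_typed_of_sem (h β (Multiset.mem_cons_self _ _)) ht
    refine ⟨k + n, ?_, by simpa using Bag.cons _ _ _ _ hk' hb⟩
    rw [Pt.msize, Multiset.map_cons, Multiset.sum_cons]
    exact Nat.add_le_add hk hn

end ExecTime

theorem mainTheorem4 {A : Type*} [Nonempty A] (v u : Term)
    (hv : v.Closed) (hv' : v.Normal) (hu : u.Closed) (hu' : u.Normal)
    (a : Multiset (Pt A)) (α : Pt A)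
    (hα : Pt.arrow a α ∈ sem v) (ha : ∀ β ∈ a, β ∈ sem u)
    (t : Term) (ht : AlphaEq t (Term.app v u)) (hconv : State.Conv (State.init t)) :
    lengthH (Cfg.state (State.init t)) ≤ ((2 * Pt.msize a + Pt.size α + 2 : ℕ) : ℕ∞) ∧
    (Pt.Ex α →
      lengthBeta (Cfg.state (State.init t)) ≤ ((2 * Pt.msize a + Pt.size α + 2 : ℕ) : ℕ∞)) := by
  cases ht with
  | app _ v' _ u' _ hvα huα =>
    have hv₁ : Pt.arrow a α ∈ sem v' := hvα.interp .nil hα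
    have hu₁ : ∀ β ∈ a, β ∈ sem u' := fun β hβ => huα.interp .nil (ha β hβ)
    obtain ⟨n₀, hn₀, hd₀⟩ := exists_typed_of_sem hv₁ (hvα.normal hv')
    obtain ⟨n₁, hn₁, hd₁⟩ := exists_bag_of_sem hu₁ (huα.normal hu')
    have haux : (a.map Pt.aux).sum = Pt.msize a := by
      rw [Pt.msize, Multiset.map_congr rfl fun β hβ => aux_eq_size_of_sem (hu₁ β hβ)]
    rw [Pt.size_arrow, haux] at hn₀
    -- The context is empty, so no condition on free variables arises and `p` can be chosen
    -- separately for each machine.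
    have key : ∀ p : Pt A → Prop,
        (State.init (Term.app v' u')).Typed p α (n₀ + n₁ + 1) := fun p =>
      ⟨α, _, 0, ⟨0, n₀ + n₁ + 1, 0, ⟨(0, n₀), (0, n₁), a, hd₀, hd₁, by simp⟩,
        ⟨by simp, rfl⟩, rfl⟩, ⟨rfl, rfl⟩, rfl⟩
    constructor
    · obtain ⟨k, hk, hk'⟩ := (key _).haltsIn_stepH hconv
      exact runLength_le hk' (by omega)
    · intro hE
      obtain ⟨k, hk, hk'⟩ := (key _).haltsIn_stepBeta hE hconv
      exact runLength_le hk' (by omega)
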